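/- All graphs are finite and simple; $\Delta(G)$ is the maximum degree of $G$ and $\nu(G)$ is the largest number of edges in a matching of $G$. For integers $d,m\ge 2$ let $\mathcal F(d,m)$ be the family of graphs $G$ with $\Delta(G)<d$ and $\nu(G)<m$ that are maximal with this property, in the sense that every graph $G'$ (possibly with more vertices) that contains $G$ as a subgraph and satisfies $|E(G')|>|E(G)|$ has $\Delta(G')\ge d$ or $\nu(G')\ge m$. Let $e(d,m)=\sup_{G\in\mathcal F(d,m)}|E(G)|$. Then for all integers $d,m\ge 2$, $$e(d,m)=(d-1)(m-1)+\left\lfloor\frac{m-1}{\lceil (d-1)/2\rceil}\right\rfloor\left\lfloor\frac{d-1}{2}\right\rfloor ,$$ and this supremum is attained by a graph in $\mathcal F(d,m)$. Moreover, this number is also the largest number of edges in any graph $G$ with $\Delta(G)<d$ and $\nu(G)<m$. -/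

import Mathlib

universe u

namespace RestrictedGraphs

/-- The matching number of `G`: the largest number of edges of a matching of `G`.
For a graph on a finite vertex type the supremum is a maximum. -/
noncomputable def matchingNumber {V : Type u} (G : SimpleGraph V) : ℕ :=
  sSup {k : ℕ | ∃ M : G.Subgraph, M.IsMatching ∧ M.edgeSet.ncard = k}

open Classical in
/-- `G` has maximum degree less than `d` and matching number less than `m`. -/
def IsRestricted (d m : ℕ) {V : Type u} [Fintype V] (G : SimpleGraph V) : Prop :=
  G.maxDegree < d ∧ matchingNumber G < m

/-- Membership of a finite simple graph in the family `F(d,m)`: `G` is restricted, and every finite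
graph (possibly with more vertices) that contains a copy of `G` and has more edges than `G` has
maximum degree at least `d` or matching number at least `m`. -/
def MemFamily (d m : ℕ) {V : Type u} [Fintype V] (G : SimpleGraph V) : Prop :=
  IsRestricted d m G ∧
    ∀ (W : Type u) [Fintype W] (G' : SimpleGraph W),
      G.IsContained G' → G.edgeSet.ncard < G'.edgeSet.ncard → ¬ IsRestricted d m G'

/-- The numbers of edges of the finite graphs with maximum degree `< d` and
matching number `< m`. -/
def restrictedEdgeCounts (d m : ℕ) : Set ℕ :=
  {k | ∃ (V : Type u) (_ : Fintype V) (G : SimpleGraph V),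
    IsRestricted d m G ∧ G.edgeSet.ncard = k}

/-- The numbers of edges of the members of the family `F(d,m)`. -/
def familyEdgeCounts (d m : ℕ) : Set ℕ :=
  {k | ∃ (V : Type u) (_ : Fintype V) (G : SimpleGraph V),
    MemFamily d m G ∧ G.edgeSet.ncard = k}

/-- `e(d,m)`, the supremum of the numbers of edges of the members of `F(d,m)`. -/
noncomputable def e (d m : ℕ) : ℕ := sSup (familyEdgeCounts.{u} d m)

/-- `(d-1)(m-1) + ⌊(m-1)/⌈(d-1)/2⌉⌋ ⌊(d-1)/2⌋`, for `d, m ≥ 1`. Here `a / b` is the rounded-down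
and `a ⌈/⌉ b` the rounded-up quotient of natural numbers. -/
def edgeBound (d m : ℕ) : ℕ :=
  (d - 1) * (m - 1) + ((m - 1) / ((d - 1) ⌈/⌉ 2)) * ((d - 1) / 2)

end RestrictedGraphs

namespace RestrictedGraphs

open SimpleGraph

/-! ### Degrees and matchings -/

section Basic

variable {V : Type*} {W : Type*}

/-! Write D = d-1, N = m-1. Upper bound: by Tutte–Berge some vertex set U satisfies |U| + Σ ⌊|C|/2⌋
≤ N, summed over the components C of G - U. At most D|U| edges meet U, and a component with k =
⌊|C|/2⌋ has at most Dk edges, plus ⌊D/2⌋ when k ≥ ⌈D/2⌉ (`ncard_edgeSet_le_of_degree_le`). At most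
⌊N/⌈D/2⌉⌋ components earn that bonus. The set U comes from Tutte's theorem applied to the join of G
with K_t, t = |V| - 2N - 2 (`exists_ncard_edgeSet_le`); if |V| ≤ 2N + 1, then U = ∅ works.
Sharpness: take disjoint near-regular graphs on 2⌈D/2⌉ + 1 vertices, as many as N allows, and spend
the remainder of N on stars K_{1,D}. A graph attaining the bound is automatically maximal. -/

theorem sum_ncard_neighborSet [Fintype V] (G : SimpleGraph V) :
    ∑ v, (G.neighborSet v).ncard = 2 * G.edgeSet.ncard := by
  classical
  have h := G.sum_degrees_eq_twice_card_edges
  rw [← coe_edgeFinset, Set.ncard_coe_finset, ← h]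
  refine Finset.sum_congr rfl fun v _ => ?_
  rw [← G.card_neighborSet_eq_degree, Set.ncard_eq_toFinset_card', Set.toFinset_card]

theorem ncard_verts_of_isMatching [Fintype V] {G : SimpleGraph V} {M : G.Subgraph}
    (hM : M.IsMatching) : M.verts.ncard = 2 * M.edgeSet.ncard := by
  classical
  have h := sum_ncard_neighborSet M.spanningCoe
  rw [Subgraph.edgeSet_spanningCoe] at h
  rw [← h, Set.ncard_eq_toFinset_card', ← Finset.sum_filter_add_sum_filter_not _ (· ∈ M.verts)]
  have h1 : ∀ v ∈ Finset.univ.filter (· ∈ M.verts),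
      (M.spanningCoe.neighborSet v).ncard = 1 := by
    intro v hv
    obtain ⟨w, hw, hu⟩ := hM (Finset.mem_filter.1 hv).2
    rw [Set.ncard_eq_one]
    exact ⟨w, Set.ext fun x => ⟨fun hx => hu x hx, fun hx => by
      rw [Set.mem_singleton_iff.1 hx]; exact hw⟩⟩
  have h0 : ∀ v ∈ Finset.univ.filter (· ∉ M.verts),
      (M.spanningCoe.neighborSet v).ncard = 0 := by
    intro v hv
    rw [Set.ncard_eq_zero]
    exact Set.eq_empty_of_forall_notMem fun x hx =>
      (Finset.mem_filter.1 hv).2 (M.edge_vert hx)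
  rw [Finset.sum_congr rfl h1, Finset.sum_congr rfl h0]
  simp only [Finset.sum_const, smul_eq_mul, mul_one, mul_zero, add_zero]
  congr 1
  ext
  simp

theorem matchingNumber_le_iff {V : Type u} [Finite V] {G : SimpleGraph V} {N : ℕ} :
    matchingNumber G ≤ N ↔ ∀ M : G.Subgraph, M.IsMatching → M.edgeSet.ncard ≤ N := by
  -- In ℕ an unbounded set has `sSup` equal to 0, so boundedness must be checked.
  have hb : BddAbove {k : ℕ | ∃ M : G.Subgraph, M.IsMatching ∧ M.edgeSet.ncard = k} := by
    refine ⟨G.edgeSet.ncard, ?_⟩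
    rintro k ⟨M, -, rfl⟩
    exact Set.ncard_le_ncard M.edgeSet_subset (Set.toFinite _)
  constructor
  · intro h M hM
    exact (le_csSup hb ⟨M, hM, rfl⟩).trans h
  · intro h
    refine csSup_le ⟨0, ⊥, fun v hv => hv.elim, by simp⟩ ?_
    rintro k ⟨M, hM, rfl⟩
    exact h M hM

theorem isRestricted_succ_iff {V : Type u} [Fintype V] {G : SimpleGraph V} {D N : ℕ} :
    IsRestricted (D + 1) (N + 1) G ↔ (∀ v, (G.neighborSet v).ncard ≤ D) ∧
      ∀ M : G.Subgraph, M.IsMatching → M.edgeSet.ncard ≤ N := by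
  classical
  have hdeg : ∀ v, (G.neighborSet v).ncard = G.degree v := fun v => by
    rw [← G.card_neighborSet_eq_degree, Set.ncard_eq_toFinset_card', Set.toFinset_card]
  rw [IsRestricted, Nat.lt_succ_iff, Nat.lt_succ_iff, matchingNumber_le_iff]
  refine and_congr_left fun _ => ⟨fun h v => ?_, fun h => ?_⟩
  · rw [hdeg]
    refine le_trans ?_ h
    convert G.degree_le_maxDegree v
  · refine le_trans (le_of_eq ?_) (G.maxDegree_le_of_forall_degree_le D fun v => hdeg v ▸ h v)
    congr

/-- A vertex whose partner lies outside the image of `f` is dropped, so what remains is still a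
matching. -/
theorem exists_isMatching_comap {G : SimpleGraph V} {H : SimpleGraph W} (f : G ↪g H)
    {M : H.Subgraph} (hM : M.IsMatching) :
    ∃ M' : G.Subgraph, M'.IsMatching ∧ ∀ a b, M'.Adj a b ↔ M.Adj (f a) (f b) := by
  refine ⟨{ verts := {a | ∃ b, M.Adj (f a) (f b)}
            Adj := fun a b => M.Adj (f a) (f b)
            adj_sub := fun h => f.map_adj_iff.1 (M.adj_sub h)
            edge_vert := fun h => ⟨_, h⟩
            symm := ⟨fun _ _ h => M.adj_symm h⟩ }, ?_, fun _ _ => Iff.rfl⟩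
  rintro a ⟨b, hb⟩
  exact ⟨b, hb, fun c hc => f.injective (hM.eq_of_adj_left hc hb)⟩

end Basic

/-! ### Counting over connected components -/

section Components

variable {V : Type*}

/-- Converts the odd components in Tutte's condition into the sum Σ ⌊|C|/2⌋ of Tutte–Berge. -/
theorem two_mul_sum_half_add_ncard_oddComponents [Fintype V] (G : SimpleGraph V)
    [Fintype G.ConnectedComponent] :
    2 * ∑ C : G.ConnectedComponent, C.supp.ncard / 2 + G.oddComponents.ncard
      = Fintype.card V := by
  classical
  have h1 : Fintype.card V = ∑ C : G.ConnectedComponent, C.supp.ncard := by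
    rw [← Finset.card_univ, Finset.card_eq_sum_card_fiberwise
      (f := G.connectedComponentMk) (t := Finset.univ) (fun _ _ => Finset.mem_univ _)]
    refine Finset.sum_congr rfl fun C _ => ?_
    rw [← Set.ncard_coe_finset]
    congr 1
    ext v
    simp [ConnectedComponent.mem_supp_iff]
  have h2 : G.oddComponents.ncard = ∑ C : G.ConnectedComponent, C.supp.ncard % 2 := by
    have : G.oddComponents = ↑(Finset.univ.filter
        fun C : G.ConnectedComponent => Odd C.supp.ncard) := by
      ext C; simp [oddComponents]
    rw [this, Set.ncard_coe_finset, Finset.card_filter]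
    refine Finset.sum_congr rfl fun C _ => ?_
    split_ifs with h
    · exact (Nat.odd_iff.1 h).symm
    · exact (Nat.even_iff.1 (Nat.not_odd_iff_even.1 h)).symm
  rw [h1, h2, Finset.mul_sum, ← Finset.sum_add_distrib]
  exact Finset.sum_congr rfl fun C _ => Nat.div_add_mod _ _

/-- A graph with `n` vertices and maximum degree at most `D` has at most
`D ⌊n/2⌋` edges, plus `⌊D/2⌋` more if `⌊n/2⌋ ≥ ⌈D/2⌉`. -/
theorem ncard_edgeSet_le_of_degree_le [Fintype V] (G : SimpleGraph V) {D : ℕ}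
    (hG : ∀ v, (G.neighborSet v).ncard ≤ D) :
    G.edgeSet.ncard ≤ D * (Fintype.card V / 2) +
      D / 2 * (if (D + 1) / 2 ≤ Fintype.card V / 2 then 1 else 0) := by
  set n := Fintype.card V with hn
  have h2 := sum_ncard_neighborSet G
  have hD : 2 * G.edgeSet.ncard ≤ n * D := by
    rw [← h2]
    simpa using! Finset.sum_le_card_nsmul Finset.univ _ D fun v _ => hG v
  have hN : 2 * G.edgeSet.ncard ≤ n * (n - 1) := by
    rw [← h2]
    refine (Finset.sum_le_card_nsmul Finset.univ _ (n - 1) fun v _ => ?_).trans (by simp [hn])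
    have : G.neighborSet v ⊆ {v}ᶜ := fun w hw => (G.ne_of_adj hw).symm
    refine (Set.ncard_le_ncard this (Set.toFinite _)).trans ?_
    rw [Set.ncard_compl, Set.ncard_singleton, Nat.card_eq_fintype_card]
  set k := n / 2 with hk
  have hnk : n = 2 * k ∨ n = 2 * k + 1 := by omega
  split_ifs with h
  · rcases hnk with e | e <;> rw [e] at hD
    · have : 2 * G.edgeSet.ncard ≤ 2 * (D * k) := by nlinarith
      omega
    · have : 2 * G.edgeSet.ncard ≤ 2 * (D * k) + D := by nlinarith
      omega
  -- Below the threshold and for odd n, the count of all pairs, k(2k+1) ≤ Dk, beats the degree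
  -- bound.
  · have hkD : 2 * k + 1 ≤ D := by omega
    rcases hnk with e | e
    · rw [e] at hD
      nlinarith
    · rw [e, Nat.add_sub_cancel] at hN
      have : (2 * k + 1) * k ≤ D * k := Nat.mul_le_mul_right _ hkD
      nlinarith

/-- Here q counts the components with ⌊|C|/2⌋ ≥ ⌈D/2⌉, the only ones that can exceed D⌊|C|/2⌋ edges.
-/
theorem exists_ncard_edgeSet_le_sum_components [Fintype V] (G : SimpleGraph V)
    [Fintype G.ConnectedComponent] {D : ℕ} (hG : ∀ v, (G.neighborSet v).ncard ≤ D) :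
    ∃ q : ℕ, q * ((D + 1) / 2) ≤ ∑ C : G.ConnectedComponent, C.supp.ncard / 2 ∧
      G.edgeSet.ncard ≤ D * ∑ C : G.ConnectedComponent, C.supp.ncard / 2 + D / 2 * q := by
  classical
  let χ : G.ConnectedComponent → ℕ :=
    fun C => if (D + 1) / 2 ≤ C.supp.ncard / 2 then 1 else 0
  refine ⟨∑ C, χ C, ?_, ?_⟩
  · rw [Finset.sum_mul]
    refine Finset.sum_le_sum fun C _ => ?_
    simp only [χ]
    split_ifs with h <;> simp [h]
  · have hC : ∀ C : G.ConnectedComponent,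
        ∑ v ∈ Finset.univ.filter (fun v => G.connectedComponentMk v = C),
          (G.neighborSet v).ncard ≤ 2 * (D * (C.supp.ncard / 2) + D / 2 * χ C) := by
      intro C
      have hdeg : ∀ v : C.supp, ((G.induce C.supp).neighborSet v).ncard
          = (G.neighborSet v).ncard := by
        intro v
        rw [← Set.ncard_image_of_injective _ Subtype.val_injective]
        congr 1
        ext w
        constructor
        · rintro ⟨w, hw, rfl⟩
          exact hw
        · intro hw
          exact ⟨⟨w, C.mem_supp_of_adj_mem_supp v.2 hw⟩, hw, rfl⟩
      have h := ncard_edgeSet_le_of_degree_le (G.induce C.supp) (D := D)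
        fun v => (hdeg v).trans_le (hG v)
      have hc : Fintype.card C.supp = C.supp.ncard := by
        rw [Set.ncard_eq_toFinset_card', Set.toFinset_card]
      rw [hc] at h
      refine le_trans (le_of_eq ?_) (Nat.mul_le_mul_left 2 h)
      rw [← sum_ncard_neighborSet, Finset.sum_congr rfl fun v _ => hdeg v]
      exact Finset.sum_subtype _ (fun v => by simp [ConnectedComponent.mem_supp_iff])
        (fun v => (G.neighborSet v).ncard)
    have h := sum_ncard_neighborSet G
    rw [← Finset.sum_fiberwise Finset.univ G.connectedComponentMk] at h
    have := Finset.sum_le_sum fun C (_ : C ∈ Finset.univ) => hC C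
    rw [h, ← Finset.mul_sum, Finset.sum_add_distrib, ← Finset.mul_sum, ← Finset.mul_sum] at this
    omega

end Components

/-! ### The upper bound -/

section UpperBound

variable {V : Type*}

/-- The join of `G` with a complete graph on `t` vertices. -/
abbrev joinComplete (G : SimpleGraph V) (t : ℕ) : SimpleGraph (V ⊕ Fin t) :=
  (Gᶜ ⊕g (⊥ : SimpleGraph (Fin t)))ᶜ

theorem joinComplete_adj_inl {G : SimpleGraph V} {t : ℕ} {a b : V} :
    (joinComplete G t).Adj (.inl a) (.inl b) ↔ G.Adj a b := by
  simp only [compl_adj, ne_eq, Sum.inl.injEq, sum_adj_inl, not_and, not_not]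
  exact ⟨fun h => h.2 h.1, fun h => ⟨h.ne, fun _ => h⟩⟩

theorem joinComplete_adj_inr {G : SimpleGraph V} {t : ℕ} {i : Fin t} {x : V ⊕ Fin t}
    (hx : x ≠ .inr i) : (joinComplete G t).Adj (.inr i) x := by
  refine (compl_adj _ _ _).2 ⟨hx.symm, ?_⟩
  cases x <;> simp

/-- If the join of `G` with a complete graph on `t` vertices has a perfect matching, then `G` has a
matching that misses at most `t` vertices. -/
theorem exists_isMatching_of_joinComplete [Fintype V] {G : SimpleGraph V} {t : ℕ}
    {M : (joinComplete G t).Subgraph} (hM : M.IsPerfectMatching) :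
    ∃ M' : G.Subgraph, M'.IsMatching ∧ Fintype.card V ≤ 2 * M'.edgeSet.ncard + t := by
  classical
  obtain ⟨M', hM', hadj⟩ := exists_isMatching_comap
    (⟨Function.Embedding.inl, joinComplete_adj_inl⟩ : G ↪g joinComplete G t) hM.1
  refine ⟨M', hM', ?_⟩
  rw [← ncard_verts_of_isMatching hM']
  -- Vertices missed by `M'` are matched by `M` to distinct vertices of K_t.
  have hex : ∀ a : ↥(M'.vertsᶜ), ∃ i : Fin t, M.Adj (.inl a.1) (.inr i) := by
    intro a
    obtain ⟨w, hw, -⟩ := hM.1 (hM.2 (.inl a.1))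
    cases w with
    | inl b => exact (a.2 (M'.edge_vert ((hadj a.1 b).2 hw))).elim
    | inr i => exact ⟨i, hw⟩
  choose g hg using hex
  have hinj : Function.Injective g := fun a b hab => Subtype.ext <| Sum.inl_injective <|
    hM.1.eq_of_adj_right (hg a) (hab ▸ hg b)
  have h := Nat.card_le_card_of_injective g hinj
  rw [Nat.card_coe_set_eq, Nat.card_fin] at h
  have := Set.ncard_add_ncard_compl M'.verts
  rw [Nat.card_eq_fintype_card] at this
  omega

/-- The Tutte violators of a graph with an even number of vertices have deficiency at least two. -/
theorem ncard_add_two_le_of_isTutteViolator [Finite V] {G : SimpleGraph V}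
    (hV : Even (Nat.card V)) {S : Set V} (hS : G.IsTutteViolator S) :
    S.ncard + 2 ≤ ((⊤ : G.Subgraph).deleteVerts S).coe.oddComponents.ncard := by
  have hlt : S.ncard < ((⊤ : G.Subgraph).deleteVerts S).coe.oddComponents.ncard := hS
  -- The number of odd components has the parity of |V∖S|, hence of |S|; a positive excess is thus
  -- at least 2.
  have hodd := odd_ncard_oddComponents (((⊤ : G.Subgraph).deleteVerts S).coe)
  have hcard : Nat.card ((⊤ : G.Subgraph).deleteVerts S).verts + S.ncard = Nat.card V := by
    rw [Nat.card_coe_set_eq, Subgraph.deleteVerts_verts, Subgraph.verts_top,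
      ← Set.compl_eq_univ_sdiff, add_comm, Set.ncard_add_ncard_compl]
  rw [Nat.even_iff] at hV
  rw [Nat.odd_iff, Nat.odd_iff] at hodd
  omega

/-- A vertex of K_t outside `S` is adjacent to everything else that remains, leaving one component,
whereas a violator leaves at least two odd ones. -/
theorem range_inr_subset_of_isTutteViolator [Finite V] {G : SimpleGraph V} {t : ℕ}
    (hV : Even (Nat.card (V ⊕ Fin t))) {S : Set (V ⊕ Fin t)}
    (hS : (joinComplete G t).IsTutteViolator S) (i : Fin t) : Sum.inr i ∈ S := by
  by_contra hi
  have h2 := ncard_add_two_le_of_isTutteViolator hV hS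
  set H := ((⊤ : (joinComplete G t).Subgraph).deleteVerts S).coe with hH
  have hsub : H.oddComponents.Subsingleton := by
    have hx : Sum.inr i ∈ ((⊤ : (joinComplete G t).Subgraph).deleteVerts S).verts := by
      simpa using hi
    have key : ∀ C : H.ConnectedComponent, C = H.connectedComponentMk ⟨_, hx⟩ := by
      intro C
      induction C using ConnectedComponent.ind with
      | _ v =>
        by_cases hv : v = ⟨_, hx⟩
        · rw [hv]
        · refine (ConnectedComponent.eq.2 (Adj.reachable ?_)).symm
          rw [hH, Subgraph.coe_adj, Subgraph.deleteVerts_adj]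
          have hv' : v.1 ∈ Set.univ \ S := v.2
          exact ⟨trivial, hi, trivial, hv'.2,
            joinComplete_adj_inr fun h => hv (Subtype.ext h)⟩
    exact fun C _ C' _ => (key C).trans (key C').symm
  have := (Set.ncard_le_one (Set.toFinite _)).2 fun _ hC _ hC' => hsub hC hC'
  omega

/-- The edges of `G` that avoid `S` number at least `|E(G)| - D |S|`. -/
theorem ncard_edgeSet_le_add_deleteVerts [Fintype V] {G : SimpleGraph V} {t D : ℕ}
    (hG : ∀ v, (G.neighborSet v).ncard ≤ D) (S : Set (V ⊕ Fin t)) :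
    G.edgeSet.ncard ≤ D * (Sum.inl ⁻¹' S : Set V).ncard +
      ((⊤ : (joinComplete G t).Subgraph).deleteVerts S).coe.edgeSet.ncard := by
  classical
  set U : Set V := Sum.inl ⁻¹' S
  set H := ((⊤ : (joinComplete G t).Subgraph).deleteVerts S).coe with hH
  have hinc : (⋃ u ∈ U.toFinset, G.incidenceSet u).ncard ≤ D * U.ncard := by
    refine (Finset.set_ncard_biUnion_le _ _).trans ?_
    rw [Set.ncard_eq_toFinset_card', mul_comm]
    refine Finset.sum_le_card_nsmul _ _ _ fun v _ => ?_
    refine le_trans (le_of_eq ?_) (hG v)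
    exact Nat.card_congr (G.incidenceSetEquivNeighborSet v)
  have hrest : (G.edgeSet \ ⋃ u ∈ U.toFinset, G.incidenceSet u).ncard ≤ H.edgeSet.ncard := by
    rw [← Set.ncard_image_of_injective _ (Sym2.map.injective (Sum.inl_injective (β := Fin t))),
      ← Set.ncard_image_of_injective H.edgeSet (Sym2.map.injective Subtype.val_injective)]
    refine Set.ncard_le_ncard ?_ (Set.toFinite _)
    rintro _ ⟨z, ⟨hz, hzU⟩, rfl⟩
    induction z using Sym2.ind with
    | _ a b =>
      rw [mem_edgeSet] at hz
      simp only [Set.mem_iUnion, not_exists] at hzU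
      have ha : Sum.inl a ∉ S := fun h =>
        hzU a (Set.mem_toFinset.2 h) ((G.mk'_mem_incidenceSet_left_iff).2 hz)
      have hb : Sum.inl b ∉ S := fun h =>
        hzU b (Set.mem_toFinset.2 h) ((G.mk'_mem_incidenceSet_right_iff).2 hz)
      refine ⟨s(⟨.inl a, ⟨trivial, ha⟩⟩, ⟨.inl b, ⟨trivial, hb⟩⟩), ?_, rfl⟩
      rw [mem_edgeSet, hH, Subgraph.coe_adj, Subgraph.deleteVerts_adj]
      exact ⟨trivial, ha, trivial, hb, joinComplete_adj_inl.2 hz⟩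
  calc G.edgeSet.ncard ≤ ((⋃ u ∈ U.toFinset, G.incidenceSet u) ∪
        (G.edgeSet \ ⋃ u ∈ U.toFinset, G.incidenceSet u)).ncard := by
        refine Set.ncard_le_ncard ?_ (Set.toFinite _)
        rw [Set.union_sdiff_self]
        exact Set.subset_union_right
    _ ≤ _ := (Set.ncard_union_le _ _).trans (Nat.add_le_add hinc hrest)

theorem ncard_neighborSet_deleteVerts_le [Fintype V] {G : SimpleGraph V} {t D : ℕ}
    (hG : ∀ v, (G.neighborSet v).ncard ≤ D) {S : Set (V ⊕ Fin t)} (hS : ∀ i, Sum.inr i ∈ S)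
    (v : ((⊤ : (joinComplete G t).Subgraph).deleteVerts S).verts) :
    (((⊤ : (joinComplete G t).Subgraph).deleteVerts S).coe.neighborSet v).ncard ≤ D := by
  obtain ⟨v | i, hv⟩ := v
  · refine le_trans ?_ (hG v)
    rw [← Set.ncard_image_of_injective _ Subtype.val_injective,
      ← Set.ncard_image_of_injective (G.neighborSet v) (Sum.inl_injective (β := Fin t))]
    refine Set.ncard_le_ncard ?_ (Set.toFinite _)
    rintro _ ⟨⟨w | i, hw⟩, hadj, rfl⟩
    · rw [mem_neighborSet, Subgraph.coe_adj, Subgraph.deleteVerts_adj] at hadj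
      exact ⟨w, joinComplete_adj_inl.1 hadj.2.2.2.2, rfl⟩
    · exact (hw.2 (hS i)).elim
  · exact (hv.2 (hS i)).elim

/-- A consequence of the Tutte–Berge formula: a graph of maximum degree at most `D` in which every
matching has at most `N` edges decomposes into at most `N` weighted pieces, which bounds its
number of edges. -/
theorem exists_ncard_edgeSet_le [Fintype V] {G : SimpleGraph V} {D N : ℕ}
    (hG : ∀ v, (G.neighborSet v).ncard ≤ D)
    (hN : ∀ M : G.Subgraph, M.IsMatching → M.edgeSet.ncard ≤ N) :
    ∃ q : ℕ, q * ((D + 1) / 2) ≤ N ∧ G.edgeSet.ncard ≤ D * N + D / 2 * q := by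
  classical
  rcases lt_or_ge (Fintype.card V) (2 * N + 2) with hn | hn
  · obtain ⟨q, hq, hE⟩ := exists_ncard_edgeSet_le_sum_components G hG
    have hK := two_mul_sum_half_add_ncard_oddComponents G
    have hKN : ∑ C : G.ConnectedComponent, C.supp.ncard / 2 ≤ N := by omega
    exact ⟨q, hq.trans hKN, hE.trans (Nat.add_le_add_right (Nat.mul_le_mul_left _ hKN) _)⟩
  · obtain ⟨t, ht⟩ : ∃ t, Fintype.card V = 2 * N + 2 + t := ⟨_, (Nat.add_sub_cancel' hn).symm⟩
    have hcard : Nat.card (V ⊕ Fin t) = 2 * (N + 1 + t) := by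
      rw [Nat.card_eq_fintype_card, Fintype.card_sum, Fintype.card_fin, ht]
      ring
    have heven : Even (Nat.card (V ⊕ Fin t)) := hcard ▸ even_two_mul _
    -- A perfect matching would give G a matching with at least (|V| - t)/2 = N + 1 edges.
    have hnot : ¬ ∃ M : (joinComplete G t).Subgraph, M.IsPerfectMatching := by
      rintro ⟨M, hM⟩
      obtain ⟨M', hM', hle⟩ := exists_isMatching_of_joinComplete hM
      have := hN M' hM'
      omega
    rw [tutte] at hnot
    push Not at hnot
    obtain ⟨S, hS⟩ := hnot
    have hmem := range_inr_subset_of_isTutteViolator heven hS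
    have hdef := ncard_add_two_le_of_isTutteViolator heven hS
    have hdel := ncard_edgeSet_le_add_deleteVerts hG S
    obtain ⟨q, hq, hE⟩ := exists_ncard_edgeSet_le_sum_components
      ((⊤ : (joinComplete G t).Subgraph).deleteVerts S).coe
      (ncard_neighborSet_deleteVerts_le hG hmem)
    have hK := two_mul_sum_half_add_ncard_oddComponents
      ((⊤ : (joinComplete G t).Subgraph).deleteVerts S).coe
    set K := ∑ C : ((⊤ : (joinComplete G t).Subgraph).deleteVerts S).coe.ConnectedComponent,
      C.supp.ncard / 2
    have hverts : Fintype.card ((⊤ : (joinComplete G t).Subgraph).deleteVerts S).verts + S.ncard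
        = Nat.card (V ⊕ Fin t) := by
      rw [← Nat.card_eq_fintype_card, Nat.card_coe_set_eq, Subgraph.deleteVerts_verts,
        Subgraph.verts_top, ← Set.compl_eq_univ_sdiff, add_comm, Set.ncard_add_ncard_compl]
    have hSU : S.ncard = (Sum.inl ⁻¹' S : Set V).ncard + t := by
      have hS' : S = Sum.inl '' (Sum.inl ⁻¹' S : Set V) ∪ Set.range Sum.inr := by
        ext x
        cases x <;> simp [hmem]
      conv_lhs => rw [hS']
      rw [Set.ncard_union_eq (by
          rw [Set.disjoint_left]
          rintro _ ⟨a, -, rfl⟩ ⟨i, hi⟩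
          cases hi) (Set.toFinite _) (Set.toFinite _),
        Set.ncard_image_of_injective _ Sum.inl_injective, ← Set.image_univ,
        Set.ncard_image_of_injective _ Sum.inr_injective, Set.ncard_univ, Nat.card_fin]
    -- With U the part of `S` in V and o the number of odd components, 2K = 2(N+1+t) - |S| - o,
    -- where |S| = |U| + t and o ≥ |S| + 2.
    have hUK : (Sum.inl ⁻¹' S : Set V).ncard + K ≤ N := by omega
    refine ⟨q, by omega, ?_⟩
    have := Nat.mul_le_mul_left D hUK
    rw [Nat.mul_add] at this
    omega

end UpperBound

theorem ceilDiv_two (D : ℕ) : D ⌈/⌉ 2 = (D + 1) / 2 := by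
  rw [Nat.ceilDiv_eq_add_pred_div]
  rfl

/-- The Chvátal–Hanson bound. -/
theorem IsRestricted.ncard_edgeSet_le {V : Type u} [Fintype V] {G : SimpleGraph V} {d m : ℕ}
    (hd : 2 ≤ d) (hm : 1 ≤ m) (hG : IsRestricted d m G) :
    G.edgeSet.ncard ≤ edgeBound d m := by
  obtain ⟨D, rfl⟩ : ∃ D, d = D + 1 := ⟨d - 1, by omega⟩
  obtain ⟨N, rfl⟩ : ∃ N, m = N + 1 := ⟨m - 1, by omega⟩
  rw [isRestricted_succ_iff] at hG
  obtain ⟨q, hq, hE⟩ := exists_ncard_edgeSet_le hG.1 hG.2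
  have hq' : q ≤ N / ((D + 1) / 2) := (Nat.le_div_iff_mul_le (by omega)).2 hq
  simp only [edgeBound, Nat.add_sub_cancel, ceilDiv_two]
  rw [mul_comm (N / _)]
  exact hE.trans (Nat.add_le_add_left (Nat.mul_le_mul_left _ hq') _)

/-! ### The extremal graphs -/

/-- There is a graph with maximum degree at most `D`, all matchings of size at most `N`, and at
least `k` edges. -/
def Achieves (D N k : ℕ) : Prop :=
  ∃ (V : Type u) (_ : Fintype V) (G : SimpleGraph V), (∀ v, (G.neighborSet v).ncard ≤ D) ∧
    (∀ M : G.Subgraph, M.IsMatching → M.edgeSet.ncard ≤ N) ∧ k ≤ G.edgeSet.ncard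

theorem achieves_zero (D : ℕ) : Achieves.{u} D 0 0 :=
  ⟨PEmpty, inferInstance, ⊥, fun v => v.elim, fun M _ => by
    rw [Set.eq_empty_of_isEmpty M.edgeSet, Set.ncard_empty], Nat.zero_le _⟩

theorem Achieves.add {D N N' k k' : ℕ} (h : Achieves.{u} D N k) (h' : Achieves.{u} D N' k') :
    Achieves.{u} D (N + N') (k + k') := by
  obtain ⟨V, _, G, hG, hM, hk⟩ := h
  obtain ⟨V', _, G', hG', hM', hk'⟩ := h'
  refine ⟨V ⊕ V', inferInstance, G ⊕g G', ?_, ?_, ?_⟩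
  · rintro (v | v)
    · rw [neighborSet_sum_inl, Set.ncard_image_of_injective _ Sum.inl_injective]
      exact hG v
    · rw [neighborSet_sum_inr, Set.ncard_image_of_injective _ Sum.inr_injective]
      exact hG' v
  · intro M h
    obtain ⟨M₁, h₁, e₁⟩ := exists_isMatching_comap (Embedding.sumInl (G := G) (H := G')) h
    obtain ⟨M₂, h₂, e₂⟩ := exists_isMatching_comap (Embedding.sumInr (G := G) (H := G')) h
    have hsub : M.edgeSet ⊆ Sym2.map Sum.inl '' M₁.edgeSet ∪ Sym2.map Sum.inr '' M₂.edgeSet := by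
      intro z
      induction z using Sym2.ind with
      | _ x y =>
        intro hz
        have hadj := M.adj_sub hz
        rcases x with x | x <;> rcases y with y | y
        · exact Or.inl ⟨s(x, y), (e₁ x y).2 hz, rfl⟩
        · simp at hadj
        · simp at hadj
        · exact Or.inr ⟨s(x, y), (e₂ x y).2 hz, rfl⟩
    refine (Set.ncard_le_ncard hsub (Set.toFinite _)).trans ((Set.ncard_union_le _ _).trans ?_)
    exact Nat.add_le_add ((Set.ncard_image_le (Set.toFinite _)).trans (hM M₁ h₁))
      ((Set.ncard_image_le (Set.toFinite _)).trans (hM' M₂ h₂))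
  · refine (Nat.add_le_add hk hk').trans (le_of_eq ?_)
    rw [← Nat.card_coe_set_eq, ← Nat.card_coe_set_eq, ← Nat.card_coe_set_eq, ← Nat.card_sum]
    exact (Nat.card_congr edgeSetSumEquiv).symm

theorem Achieves.nsmul {D N k : ℕ} (h : Achieves.{u} D N k) (n : ℕ) :
    Achieves.{u} D (n * N) (n * k) := by
  induction n with
  | zero => simpa using achieves_zero D
  | succ n ih => simpa only [Nat.succ_mul] using ih.add h

/-- The star K_{1,D} with centre `none`: all edges share the centre, so no two are disjoint. -/
theorem achieves_star (D : ℕ) (hD : 1 ≤ D) : Achieves.{u} D 1 D := by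
  classical
  let G : SimpleGraph (Option (ULift.{u} (Fin D))) := SimpleGraph.fromRel fun x _ => x = none
  have hadj : ∀ x y, G.Adj x y → x = none ∨ y = none := fun x y h => h.2
  refine ⟨Option (ULift.{u} (Fin D)), inferInstance, G, ?_, ?_, ?_⟩
  · rintro (_ | i)
    · have : G.neighborSet none ⊆ {none}ᶜ := fun w hw => (G.ne_of_adj hw).symm
      refine (Set.ncard_le_ncard this (Set.toFinite _)).trans ?_
      rw [Set.ncard_compl, Set.ncard_singleton, Nat.card_eq_fintype_card]
      simp
    · have : G.neighborSet (some i) ⊆ {none} := fun w hw => by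
        simpa using hadj _ _ hw
      exact (Set.ncard_le_ncard this (Set.toFinite _)).trans (by simpa using hD)
  · intro M hM
    rw [Set.ncard_le_one (Set.toFinite _)]
    have key : ∀ z ∈ M.edgeSet, ∃ w, z = s(none, w) ∧ M.Adj none w := by
      intro z
      induction z using Sym2.ind with
      | _ x y =>
        intro hz
        rcases hadj x y (M.adj_sub hz) with rfl | rfl
        · exact ⟨y, rfl, hz⟩
        · exact ⟨x, Sym2.eq_swap, M.adj_symm hz⟩
    intro z hz z' hz'
    obtain ⟨w, rfl, hw⟩ := key z hz
    obtain ⟨w', rfl, hw'⟩ := key z' hz'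
    rw [hM.eq_of_adj_left hw hw']
  · let f : Fin D → Sym2 (Option (ULift.{u} (Fin D))) := fun i => s(none, some ⟨i⟩)
    have hf : Function.Injective f := fun i j h => by
      simpa [f] using h
    have hsub : Set.range f ⊆ G.edgeSet := by
      rintro _ ⟨i, rfl⟩
      exact ⟨by simp, Or.inl rfl⟩
    refine le_trans (le_of_eq ?_) (Set.ncard_le_ncard hsub (Set.toFinite _))
    rw [← Set.image_univ, Set.ncard_image_of_injective _ hf, Set.ncard_univ, Nat.card_fin]

/-- Deleting the edges of `S` from a complete graph with `2c+1` vertices. -/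
theorem achieves_deleteEdges_top {c D s : ℕ} (S : Set (Sym2 (Fin (2 * c + 1))))
    (hS : S.ncard ≤ s)
    (hdeg : ∀ v, (((⊤ : SimpleGraph (Fin (2 * c + 1))).deleteEdges S).neighborSet v).ncard ≤ D) :
    Achieves.{u} D c (c * (2 * c + 1) - s) := by
  classical
  set G := (⊤ : SimpleGraph (Fin (2 * c + 1))).deleteEdges S with hG
  let e : G ≃g G.map (Equiv.ulift.{u}.symm : Fin (2 * c + 1) ≃ _).toEmbedding := Iso.map _ G
  refine ⟨ULift.{u} (Fin (2 * c + 1)), inferInstance,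
    G.map (Equiv.ulift.{u}.symm : Fin (2 * c + 1) ≃ _).toEmbedding, ?_, ?_, ?_⟩
  · intro v
    obtain ⟨v, rfl⟩ := e.surjective v
    rw [← Nat.card_coe_set_eq, ← Nat.card_congr (e.mapNeighborSet v), Nat.card_coe_set_eq]
    exact hdeg v
  · intro M hM
    -- A matching covers an even number of the 2c+1 vertices, hence has at most c edges.
    have h := ncard_verts_of_isMatching hM
    have h' := Set.ncard_le_card M.verts
    simp at h'
    omega
  · rw [← Nat.card_coe_set_eq, ← Nat.card_congr e.mapEdgeSet, Nat.card_coe_set_eq, hG,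
      edgeSet_deleteEdges]
    have htop : (⊤ : SimpleGraph (Fin (2 * c + 1))).edgeSet.ncard = c * (2 * c + 1) := by
      rw [← coe_edgeFinset, Set.ncard_coe_finset, card_edgeFinset_top_eq_card_choose_two,
        Fintype.card_fin, Nat.choose_two_right, Nat.add_sub_cancel, mul_comm, mul_assoc,
        Nat.mul_div_cancel_left _ two_pos]
    have := Set.le_ncard_sdiff S (⊤ : SimpleGraph (Fin (2 * c + 1))).edgeSet
    omega

/-- For D = 2c take K_{2c+1}. For D = 2c+1 take K_{2c+3} minus c+2 edges that together cover every
vertex, which lowers each degree from 2c+2 to at most D. -/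
theorem achieves_nearRegular (D : ℕ) (hD : 1 ≤ D) :
    Achieves.{u} D ((D + 1) / 2) (D * ((D + 1) / 2) + D / 2) := by
  rcases Nat.even_or_odd' D with ⟨c, rfl | rfl⟩
  · have h := achieves_deleteEdges_top (c := c) (D := 2 * c) (s := 0) ∅ (by simp) fun v => by
      have : ((⊤ : SimpleGraph (Fin (2 * c + 1))).deleteEdges ∅).neighborSet v ⊆ {v}ᶜ :=
        fun w hw => (deleteEdges_adj.1 hw).1.ne'
      refine (Set.ncard_le_ncard this (Set.toFinite _)).trans ?_
      rw [Set.ncard_compl, Set.ncard_singleton, Nat.card_fin, Nat.add_sub_cancel]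
    have h1 : (2 * c + 1) / 2 = c := by omega
    have h2 : 2 * c / 2 = c := by omega
    rw [h1, h2]
    convert h using 1
    rw [Nat.sub_zero]
    ring
  -- The pairs {i, i+c+1} for 0 ≤ i ≤ c+1 cover all 2c+3 vertices; only c+1 is covered twice.
  · let f : Fin (c + 2) → Sym2 (Fin (2 * (c + 1) + 1)) :=
      fun i => s(⟨i, by omega⟩, ⟨i + (c + 1), by omega⟩)
    have h := achieves_deleteEdges_top (c := c + 1) (D := 2 * c + 1) (s := c + 2) (Set.range f)
      (by
        rw [← Set.image_univ]
        exact (Set.ncard_image_le (Set.toFinite _)).trans (by simp [Set.ncard_univ]))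
      fun v => by
        obtain ⟨w, hwv, hw⟩ : ∃ w, w ≠ v ∧ s(v, w) ∈ Set.range f := by
          rcases Nat.lt_or_ge v.1 (c + 2) with hv | hv
          · exact ⟨⟨v + (c + 1), by omega⟩, by simp [Fin.ext_iff], ⟨v, hv⟩, rfl⟩
          · refine ⟨⟨v - (c + 1), by omega⟩, by simp [Fin.ext_iff]; omega,
              ⟨v - (c + 1), by omega⟩, ?_⟩
            have : v.1 - (c + 1) + (c + 1) = v := by omega
            simp only [f, this]
            exact Sym2.eq_swap
        have : ((⊤ : SimpleGraph (Fin (2 * (c + 1) + 1))).deleteEdges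
            (Set.range f)).neighborSet v ⊆ {v, w}ᶜ := by
          rintro x hx (rfl | rfl)
          · exact (deleteEdges_adj.1 hx).1.ne rfl
          · exact (deleteEdges_adj.1 hx).2 hw
        refine (Set.ncard_le_ncard this (Set.toFinite _)).trans ?_
        rw [Set.ncard_compl, Set.ncard_pair hwv.symm, Nat.card_fin]
        omega
    have h1 : (2 * c + 1 + 1) / 2 = c + 1 := by omega
    have h2 : (2 * c + 1) / 2 = c := by omega
    rw [h1, h2]
    convert h using 1
    rw [eq_comm, Nat.sub_eq_iff_eq_add (by nlinarith)]
    ring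

/-- Both building blocks give D edges per unit of N; each near-regular block adds ⌊D/2⌋ and uses
⌈D/2⌉ units, so division with remainder gives the bound. -/
theorem exists_isRestricted_le_ncard_edgeSet {d m : ℕ} (hd : 2 ≤ d) (hm : 1 ≤ m) :
    ∃ (V : Type u) (_ : Fintype V) (G : SimpleGraph V),
      IsRestricted d m G ∧ edgeBound d m ≤ G.edgeSet.ncard := by
  obtain ⟨D, rfl⟩ : ∃ D, d = D + 1 := ⟨d - 1, by omega⟩
  obtain ⟨N, rfl⟩ : ∃ N, m = N + 1 := ⟨m - 1, by omega⟩
  have hD : 1 ≤ D := by omega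
  obtain ⟨V, _, G, hG, hM, hk⟩ :=
    ((achieves_nearRegular.{u} D hD).nsmul (N / ((D + 1) / 2))).add
      ((achieves_star.{u} D hD).nsmul (N % ((D + 1) / 2)))
  have hN := Nat.div_add_mod' N ((D + 1) / 2)
  rw [Nat.mul_one, hN] at hM
  refine ⟨V, inferInstance, G, isRestricted_succ_iff.2 ⟨hG, hM⟩, le_trans (le_of_eq ?_) hk⟩
  rw [edgeBound, Nat.add_sub_cancel, Nat.add_sub_cancel, ceilDiv_two]
  conv_lhs => enter [1, 2]; rw [← hN]
  ring

end RestrictedGraphs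

theorem mainTheorem1 (d m : ℕ) (hd : 2 ≤ d) (hm : 2 ≤ m) :
    RestrictedGraphs.e.{u} d m = RestrictedGraphs.edgeBound d m ∧
    IsGreatest (RestrictedGraphs.familyEdgeCounts.{u} d m) (RestrictedGraphs.edgeBound d m) ∧
    IsGreatest (RestrictedGraphs.restrictedEdgeCounts.{u} d m)
      (RestrictedGraphs.edgeBound d m) := by
  have hm1 : 1 ≤ m := by omega
  obtain ⟨V, _, G, hG, hle⟩ := RestrictedGraphs.exists_isRestricted_le_ncard_edgeSet.{u} hd hm1
  have heq := le_antisymm (hG.ncard_edgeSet_le hd hm1) hle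
  have hfam : IsGreatest (RestrictedGraphs.familyEdgeCounts.{u} d m)
      (RestrictedGraphs.edgeBound d m) := by
    refine ⟨⟨V, inferInstance, G, ⟨hG, fun W _ G' _ hlt hG' => ?_⟩, heq⟩, ?_⟩
    -- Maximality needs no containment: no restricted graph at all has more edges than `edgeBound d
    -- m`.
    · exact (hG'.ncard_edgeSet_le hd hm1).not_gt (heq ▸ hlt)
    · rintro k ⟨W, _, G', hG', rfl⟩
      exact hG'.1.ncard_edgeSet_le hd hm1
  refine ⟨hfam.csSup_eq, hfam, ⟨V, inferInstance, G, hG, heq⟩, ?_⟩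
  rintro k ⟨W, _, G', hG', rfl⟩
  exact hG'.ncard_edgeSet_le hd hm1
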